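/- **Model.** A network is a simple, connected, undirected graph $G=(V,E,W)$ with $n=|V|\ge 2$ nodes, edge weights $W:E\to\{1,2,3,\dots\}$, and pairwise distinct node identifiers in $\mathbb{N}_0$. Execution is deterministic and proceeds in synchronous rounds; all nodes run the same algorithm, and local computation is free. In every round each node may send a (possibly different) message of $B$ bits to each of its neighbors; then it receives the messages its neighbors have sent. Initially a node knows only its own identifier, the identifiers of its neighbors and the weights of its incident edges (in particular, not $n$); the algorithm may depend on $\varepsilon$, on $B$ and on the constants $a,\beta_1,\beta_2,\varepsilon_0$ below. A problem is solved within $T$ rounds if every node irrevocably writes its output into its output register by the end of round $T$. Let $\mathrm{wd}(v,w)$ be the minimum total weight of a path from $v$ to $w$. In *$(1+\varepsilon)$-approximate all-pairs shortest paths (APSP)* each node $v$ must output a table that contains, for exactly the identifiers of the nodes $w\in V$, an integer estimate $\mathrm{dist}_v(w)$ with $\mathrm{wd}(v,w)\le \mathrm{dist}_v(w)\le(1+\varepsilon)\,\mathrm{wd}(v,w)$, together with next-hop pointers $\mathrm{next}_v(w)$ such that for all $v,w\in V$ the sequence $v_0=v$, $v_{i+1}=\mathrm{next}_{v_i}(w)$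 follows edges of $G$ and reaches $w$ along a path of weight at most $(1+\varepsilon)\,\mathrm{wd}(v,w)$. **Theorem.** $(1+\varepsilon)$-approximate APSP can be solved deterministically in the CONGEST model in $O\!\left(\frac{n}{\varepsilon^2}\log n\right)$ rounds, for $0<\varepsilon\in O(1)$, message size $B\in\Theta(\log n)$, and edge weights and identifiers bounded by a polynomial in $n$. Precisely: for all $a\in\mathbb{N}_0$ and all reals $\beta_1>0$, $\beta_2$, $\varepsilon_0$ there is a constant $C$ such that for all $0<\varepsilon\le\varepsilon_0$ and all $B\in\mathbb{N}_0$ there is a deterministic algorithm with $B$-bit messages that, on every network with $n\ge 2$ nodes such that $\beta_1\log n\le B\le\beta_2\log n$ and all edge weights and identifiers are at most $n^a$, solves $(1+\varepsilon)$-approximate APSP within at most $C\cdot\frac{n}{\varepsilon^2}\cdot\log n$ rounds. -/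

import Mathlib

/-- A network: a simple connected graph with positive integer edge weights, whose nodes carry
pairwise distinct identifiers. (`weight` is only ever evaluated at edges of the graph.) -/
structure Network (V : Type*) where
  graph : SimpleGraph V
  connected : graph.Connected
  weight : Sym2 V → ℕ
  weight_pos : ∀ e ∈ graph.edgeSet, 0 < weight e
  id : V → ℕ
  id_injective : Function.Injective id

/-- What a node is given before the first round: its own identifier, and the set of all pairs
(identifier of `u`, weight of the edge to `u`), where `u` runs over its neighbors. -/
structure LocalInput where
  id : ℕ
  links : Set (ℕ × ℕ)

namespace Network

variable {V : Type*} (N : Network V)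

/-- The initial knowledge of node `v`. The number of nodes is not part of it. -/
def localInput (v : V) : LocalInput where
  id := N.id v
  links := {q | ∃ u, N.graph.Adj v u ∧ q = (N.id u, N.weight s(v, u))}

/-- The weight of a path: its total edge weight. -/
def pathWeight {v w : V} (p : N.graph.Walk v w) : ℕ :=
  (p.edges.map N.weight).sum

/-- The weighted distance: the minimum weight of a path (one exists, by connectedness). -/
noncomputable def wdist (v w : V) : ℕ :=
  sInf (Set.range fun p : N.graph.Walk v w => N.pathWeight p)

end Network

/-- A deterministic algorithm for the synchronous message passing model in which every message
has `B` bits. All nodes run the same algorithm; local computation is unrestricted.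
* `init` computes the initial state of a node from its local input;
* `send s x` is the message (if any) sent to the neighbor with identifier `x` by a node in
  state `s`;
* `receive s M` is the next state of a node in state `s` that receives the set `M` of messages,
  each of them tagged with the identifier of the neighbor that has sent it;
* `output s` is the content of the output register, `none` as long as nothing is written. -/
structure CongestAlgorithm (B : ℕ) (Out : Type) where
  State : Type
  init : LocalInput → State
  send : State → ℕ → Option (BitVec B)
  receive : State → Set (ℕ × BitVec B) → State
  output : State → Option Out

namespace CongestAlgorithm

variable {B : ℕ} {Out : Type} (A : CongestAlgorithm B Out) {V : Type*} (N : Network V)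

/-- The state of node `v` at the end of round `t` (`t = 0`: before the first round). In every
round each node may send one message of `B` bits over each of its edges. -/
def state : ℕ → V → A.State
  | 0, v => A.init (N.localInput v)
  | t + 1, v => A.receive (state t v)
      {q | ∃ u, N.graph.Adj u v ∧ q.1 = N.id u ∧ A.send (state t u) (N.id v) = some q.2}

/-- On the network `N`, the algorithm computes the outputs `out` within `T` rounds: each node `v`
writes `out v` into its (until then empty) output register at the end of some round `t ≤ T`, and
never changes it afterwards. -/
def ComputesWithin (T : ℕ) (out : V → Out) : Prop :=
  ∀ v, ∃ t ≤ T, (∀ s, s < t → A.output (A.state N s v) = none) ∧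
    ∀ s, t ≤ s → A.output (A.state N s v) = some (out v)

end CongestAlgorithm

/-- The table that a node outputs: for the identifier of a destination, an estimate of the
weighted distance, and the identifier of the neighbor that is the next hop. -/
structure RoutingTable where
  dist : ℕ → Option ℕ
  next : ℕ → Option ℕ

/-- The tables `out` solve `(1 + ε)`-approximate all-pairs shortest paths on `N` (without
relabeling):
* the distance table of each node has exactly one entry for every node of the network;
* each estimate is at least the distance and at most `1 + ε` times the distance;
* from every `v`, following the `next` pointers for destination `w` yields a path to `w`
  of weight at most `1 + ε` times the distance. -/
structure Network.IsApproxAPSP {V : Type*} (N : Network V) (ε : ℝ) (out : V → RoutingTable) :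
    Prop where
  domain : ∀ v x, ((out v).dist x).isSome ↔ x ∈ Set.range N.id
  estimate : ∀ v w, ∀ d ∈ (out v).dist (N.id w),
    N.wdist v w ≤ d ∧ (d : ℝ) ≤ (1 + ε) * N.wdist v w
  route : ∀ v w, ∃ p : N.graph.Walk v w,
    (∀ a ∈ p.darts, (out a.fst).next (N.id w) = some (N.id a.snd)) ∧
    (N.pathWeight p : ℝ) ≤ (1 + ε) * N.wdist v w

/-! The idea is to round the weights at every distance scale and to run a pipelined flooding at all
scales at once.

Flooding: every node lists its known targets by (distance, identifier) and announces the target at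
position `q` in round distance + `q`. This sum strictly increases along the list, so at most one
target is due per round. If `u` follows `v` on a shortest path to `s`, then `s` stands no later in
the list of `u` than in that of `v`. Hence `u` announces `s` in time, and `v` knows its distance to
`s` by round distance + rank (`exists_mem_flood`).

Counting: with unit lengths, distance is at most rank, so more than `r / 2` nodes are known after `r
< 2 * n` rounds. At `r = 2 * n` this fails for the first time, at all nodes simultaneously; this
reveals `n`.

Rounding: let `m = ⌈1 / ε⌉`. At level `i` the scaled weight `m * n * w` is rounded up to a multiple
of `2 ^ i`. A simple path gains at most `2 ^ i * n`, which is a `1 / m` fraction of its scaled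
weight if `2 ^ i` is at most its weight (`mul_cost_le`). If the distance is below `2 ^ (i + 1)`, the
rounded distance is at most `2 * m * n + n`, so `O(m * n)` rounds suffice. The least cost over all
levels decreases along next hops by at least the scaled edge weight, so the pointers give a walk no
heavier than the estimate (`exists_walk_next_eq`).

Bandwidth: one broadcast carries `O(log n)` bits for each of `O(log n)` levels and is cut into `k =
O(log n)` messages of `B` bits. -/

namespace Network

/-! ### Weighted distances and the ranking of targets. -/

variable {V : Type*} (N : Network V)

@[simp]
theorem pathWeight_cons {u v w : V} (h : N.graph.Adj u v) (p : N.graph.Walk v w) :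
    N.pathWeight (SimpleGraph.Walk.cons h p) = N.weight s(u, v) + N.pathWeight p := by
  simp [pathWeight]

@[simp]
theorem pathWeight_nil (v : V) : N.pathWeight (SimpleGraph.Walk.nil : N.graph.Walk v v) = 0 := by
  simp [pathWeight]

theorem wdist_le_pathWeight {v w : V} (p : N.graph.Walk v w) : N.wdist v w ≤ N.pathWeight p :=
  Nat.sInf_le ⟨p, rfl⟩

theorem exists_pathWeight_eq_wdist (v w : V) :
    ∃ p : N.graph.Walk v w, N.pathWeight p = N.wdist v w := by
  obtain ⟨p⟩ := N.connected.preconnected v w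
  exact Nat.sInf_mem (s := Set.range fun p : N.graph.Walk v w => N.pathWeight p) ⟨_, p, rfl⟩

theorem pathWeight_bypass_le [DecidableEq V] {v w : V} (p : N.graph.Walk v w) :
    N.pathWeight p.bypass ≤ N.pathWeight p :=
  List.Sublist.sum_le_sum (p.edges_bypass_sublist_edges.map _) (by simp)

theorem exists_isPath_pathWeight_eq_wdist (v w : V) :
    ∃ p : N.graph.Walk v w, p.IsPath ∧ N.pathWeight p = N.wdist v w := by
  classical
  obtain ⟨p, hp⟩ := N.exists_pathWeight_eq_wdist v w
  exact ⟨p.bypass, p.bypass_isPath,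
    le_antisymm ((N.pathWeight_bypass_le p).trans hp.le) (N.wdist_le_pathWeight _)⟩

@[simp]
theorem wdist_self (v : V) : N.wdist v v = 0 :=
  Nat.le_zero.1 ((N.wdist_le_pathWeight SimpleGraph.Walk.nil).trans (by simp))

theorem wdist_le_weight_add {u v : V} (h : N.graph.Adj v u) (w : V) :
    N.wdist v w ≤ N.weight s(v, u) + N.wdist u w := by
  obtain ⟨p, hp⟩ := N.exists_pathWeight_eq_wdist u w
  simpa [hp] using N.wdist_le_pathWeight (SimpleGraph.Walk.cons h p)

theorem exists_adj_wdist_eq {v w : V} (h : v ≠ w) :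
    ∃ u, N.graph.Adj v u ∧ N.wdist v w = N.weight s(v, u) + N.wdist u w := by
  obtain ⟨p, hp⟩ := N.exists_pathWeight_eq_wdist v w
  cases p with
  | nil => exact absurd rfl h
  | @cons _ u _ hu p =>
    refine ⟨u, hu, le_antisymm (N.wdist_le_weight_add hu w) ?_⟩
    rw [← hp, pathWeight_cons]
    have := N.wdist_le_pathWeight p
    omega

theorem weight_pos_of_adj {u v : V} (h : N.graph.Adj v u) : 0 < N.weight s(v, u) :=
  N.weight_pos _ h

theorem wdist_pos {v w : V} (h : v ≠ w) : 0 < N.wdist v w := by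
  obtain ⟨u, hu, e⟩ := N.exists_adj_wdist_eq h
  have := N.weight_pos_of_adj hu
  omega

theorem wdist_le_mul_card [Fintype V] {b : ℕ} (hb : ∀ e ∈ N.graph.edgeSet, N.weight e ≤ b)
    (v w : V) : N.wdist v w ≤ Fintype.card V * b := by
  obtain ⟨p, hp, e⟩ := N.exists_isPath_pathWeight_eq_wdist v w
  have h := List.sum_le_card_nsmul (p.edges.map N.weight) b (by
    simp only [List.mem_map, forall_exists_index, and_imp, forall_apply_eq_imp_iff₂]
    exact fun x hx => hb x (p.edges_subset_edgeSet hx))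
  rw [← e]
  refine h.trans ?_
  simp only [List.length_map, SimpleGraph.Walk.length_edges, smul_eq_mul]
  exact Nat.mul_le_mul_right _ hp.length_lt.le

/-- The network obtained by applying `f` to all edge weights. -/
def reweight (f : ℕ → ℕ) (hf : ∀ x, 0 < f x) : Network V :=
  { N with
    weight := fun e => f (N.weight e)
    weight_pos := fun _ _ => hf _ }

/-- `N.Precedes v x y`: as targets of `v`, the node `x` comes before the node `y` in the order by
distance from `v`, with ties broken by identifiers. -/
def Precedes (v x y : V) : Prop :=
  N.wdist v x < N.wdist v y ∨ N.wdist v x = N.wdist v y ∧ N.id x < N.id y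

/-- The number of nodes that precede `x` in the list of targets of `v`. -/
noncomputable def rank (v x : V) : ℕ :=
  {y | N.Precedes v y x}.ncard

variable {N}

theorem Precedes.trans {v x y z : V} (h : N.Precedes v x y) (h' : N.Precedes v y z) :
    N.Precedes v x z := by
  unfold Precedes at *
  omega

theorem not_precedes_self (v x : V) : ¬ N.Precedes v x x := by
  simp [Precedes]

theorem precedes_or_precedes {v x y : V} (h : x ≠ y) :
    N.Precedes v x y ∨ N.Precedes v y x := by
  have := N.id_injective.ne h
  unfold Precedes
  omega

theorem Precedes.wdist_le {v x y : V} (h : N.Precedes v x y) : N.wdist v x ≤ N.wdist v y := by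
  unfold Precedes at h
  omega

theorem pathWeight_of_weight_eq_one (h : ∀ e, N.weight e = 1) {v w : V} (p : N.graph.Walk v w) :
    N.pathWeight p = p.length := by
  induction p with
  | nil => simp
  | cons _ p ih => simp [h, ih, add_comm]

variable [Finite V]

theorem Precedes.rank_lt {v x y : V} (h : N.Precedes v x y) : N.rank v x < N.rank v y :=
  Set.ncard_lt_ncard
    ((Set.ssubset_iff_of_subset fun _ hz => Precedes.trans hz h).2 ⟨x, h, not_precedes_self v x⟩)
    (Set.toFinite _)

theorem rank_injective (v : V) : Function.Injective (N.rank v) := by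
  intro x y h
  by_contra hne
  rcases precedes_or_precedes (N := N) (v := v) hne with h' | h' <;>
    exact absurd h (by have := h'.rank_lt; omega)

theorem rank_lt_card [Fintype V] (v x : V) : N.rank v x < Fintype.card V := by
  rw [← Nat.card_eq_fintype_card, ← Set.ncard_univ]
  exact Set.ncard_lt_ncard
    ((Set.ssubset_iff_of_subset (Set.subset_univ _)).2 ⟨x, trivial, not_precedes_self v x⟩)
    (Set.toFinite _)

/-- If the weighted distance to `x` decreases by exactly the weight of the edge to `u`, then `x`
does not come later in the list of `u` than in the list of `v`. -/
theorem rank_le_rank_of_wdist_eq {v u x : V} (h : N.graph.Adj v u)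
    (e : N.wdist v x = N.weight s(v, u) + N.wdist u x) : N.rank u x ≤ N.rank v x := by
  refine Set.ncard_le_ncard (fun y hy => ?_) (Set.toFinite _)
  have := N.wdist_le_weight_add h y
  simp only [Precedes, Set.mem_ofPred_eq] at hy ⊢
  omega

/-- Ranks are injective and below the number of nodes, so every value in that range is attained. -/
theorem le_ncard_rank_le [Fintype V] (v : V) (m : ℕ) :
    min (Fintype.card V) (m + 1) ≤ {x | N.rank v x ≤ m}.ncard := by
  classical
  have himg : Finset.univ.image (N.rank v) = Finset.range (Fintype.card V) :=
    Finset.eq_of_subset_of_card_le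
      (by intro j; simp only [Finset.mem_image, Finset.mem_range]
          rintro ⟨x, -, rfl⟩; exact rank_lt_card v x)
      (by rw [Finset.card_image_of_injective _ (rank_injective v)]; simp)
  rw [← Finset.card_range (min _ _), ← Set.ncard_coe_finset]
  refine le_trans (Set.ncard_le_ncard (t := N.rank v '' {x | N.rank v x ≤ m}) ?_ (Set.toFinite _))
    (Set.ncard_image_le (Set.toFinite _))
  intro j hj
  simp only [Finset.coe_range, Set.mem_Iio, lt_min_iff] at hj
  have : j ∈ Finset.univ.image (N.rank v) := by rw [himg]; simpa using hj.1
  obtain ⟨x, -, rfl⟩ := Finset.mem_image.1 this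
  exact ⟨x, Nat.lt_succ_iff.1 hj.2, rfl⟩

/-- The vertices of a shortest path before its end are distinct, and all of them are strictly closer
to `v` than `x` is. -/
theorem wdist_le_rank (h : ∀ e, N.weight e = 1) (v x : V) : N.wdist v x ≤ N.rank v x := by
  obtain ⟨p, hp, e⟩ := N.exists_isPath_pathWeight_eq_wdist v x
  rw [pathWeight_of_weight_eq_one h] at e
  rw [← e, ← Finset.card_range p.length, ← Set.ncard_coe_finset,
    ← (hp.getVert_injOn.mono (s₁ := ↑(Finset.range p.length)) (by
      intro j; simpa using le_of_lt)).ncard_image]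
  refine Set.ncard_le_ncard ?_ (Set.toFinite _)
  rintro _ ⟨j, hj, rfl⟩
  simp only [Finset.coe_range, Set.mem_Iio] at hj
  refine Or.inl ?_
  have h' := N.wdist_le_pathWeight (p.take j)
  rw [pathWeight_of_weight_eq_one h, SimpleGraph.Walk.take_length] at h'
  omega

end Network

/-! ### Simulating broadcasts of long messages by short ones. -/

/-- A broadcast algorithm: in every round, every node sends the same message of an arbitrary
type to all of its neighbors. -/
structure BroadcastAlgorithm (Msg Out : Type) where
  State : Type
  init : LocalInput → State
  message : State → Msg
  receive : State → Set (ℕ × Msg) → State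
  output : State → Option Out

namespace BroadcastAlgorithm

variable {Msg Out : Type} (A : BroadcastAlgorithm Msg Out) {V : Type*} (N : Network V)

/-- The state of node `v` at the end of round `t`. -/
def state : ℕ → V → A.State
  | 0, v => A.init (N.localInput v)
  | t + 1, v => A.receive (state t v)
      {q | ∃ u, N.graph.Adj u v ∧ q = (N.id u, A.message (state t u))}

variable {B : ℕ} (k : ℕ) (enc : Msg → ℕ → BitVec B)

open Classical in
/-- The simulation of a broadcast algorithm with messages of `B` bits: a message `g` is sent in
the `k` pieces `enc g 0, …, enc g (k - 1)`. The state consists of the simulated state, the number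
of pieces exchanged so far, and these pieces. -/
noncomputable def toCongest : CongestAlgorithm B Out where
  State := A.State × ℕ × (ℕ → Set (ℕ × BitVec B))
  init I := (A.init I, 0, fun _ => ∅)
  send s _ := some (enc (A.message s.1) s.2.1)
  receive s M :=
    let buf := Function.update s.2.2 s.2.1 M
    if s.2.1 + 1 = k then
      (A.receive s.1 {q | ∀ i < k, (q.1, enc q.2 i) ∈ buf i}, 0, buf)
    else (s.1, s.2.1 + 1, buf)
  output s := A.output s.1

/-- The set of `i`-th pieces that node `v` receives in the simulation of round `r + 1`. -/
def pieces (r : ℕ) (v : V) (i : ℕ) : Set (ℕ × BitVec B) :=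
  {q | ∃ u, N.graph.Adj u v ∧ q = (N.id u, enc (A.message (A.state N r u)) i)}

variable {k enc}

/-- Identifiers are distinct, so pieces with the same tag come from the same neighbor, and `henc`
recovers its message from them. -/
theorem setOf_forall_mem_pieces (hk : 0 < k)
    (henc : ∀ g g', (∀ i < k, enc g i = enc g' i) → g = g') (r : ℕ) (v : V) :
    {q : ℕ × Msg | ∀ i < k, (q.1, enc q.2 i) ∈ A.pieces N enc r v i} =
      {q | ∃ u, N.graph.Adj u v ∧ q = (N.id u, A.message (A.state N r u))} := by
  ext ⟨x, g⟩
  simp only [pieces, Set.mem_ofPred_eq, Prod.mk.injEq]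
  constructor
  · intro h
    obtain ⟨u, hu, rfl, -⟩ := h 0 hk
    refine ⟨u, hu, rfl, henc _ _ fun i hi => ?_⟩
    obtain ⟨u', -, hid, e⟩ := h i hi
    rwa [N.id_injective hid]
  · rintro ⟨u, hu, rfl, rfl⟩ i -
    exact ⟨u, hu, rfl, rfl⟩

/-- Buffer entries from `t % k` on may be left over from an earlier simulated round; the invariant
therefore covers only smaller indices. -/
theorem toCongest_state (hk : 0 < k)
    (henc : ∀ g g', (∀ i < k, enc g i = enc g' i) → g = g') (t : ℕ) (v : V) :
    ((A.toCongest k enc).state N t v).1 = A.state N (t / k) v ∧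
      ((A.toCongest k enc).state N t v).2.1 = t % k ∧
      ∀ i < t % k, ((A.toCongest k enc).state N t v).2.2 i = A.pieces N enc (t / k) v i := by
  induction t generalizing v with
  | zero => simp [CongestAlgorithm.state, toCongest, state]
  | succ t ih =>
    have hM : {q : ℕ × BitVec B | ∃ u, N.graph.Adj u v ∧ q.1 = N.id u ∧
        (A.toCongest k enc).send ((A.toCongest k enc).state N t u) (N.id v) = some q.2} =
        A.pieces N enc (t / k) v (t % k) := by
      ext ⟨x, b⟩
      simp only [toCongest, pieces, Set.mem_ofPred_eq, Option.some.injEq, Prod.mk.injEq]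
      refine exists_congr fun u => and_congr_right fun _ => and_congr_right fun _ => ?_
      have h1 := (ih u).1
      have h2 := (ih u).2.1
      simp only [toCongest] at h1 h2
      rw [h1, h2]
      exact eq_comm
    have hs : (A.toCongest k enc).state N (t + 1) v =
        (A.toCongest k enc).receive ((A.toCongest k enc).state N t v)
          (A.pieces N enc (t / k) v (t % k)) := by
      rw [← hM]; rfl
    obtain ⟨h1, h2, h3⟩ := ih v
    have hbuf : ∀ i < t % k + 1,
        Function.update ((A.toCongest k enc).state N t v).2.2 (t % k)
          (A.pieces N enc (t / k) v (t % k)) i = A.pieces N enc (t / k) v i := by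
      intro i hi
      rcases Nat.lt_succ_iff_lt_or_eq.1 hi with hi | rfl
      · rw [Function.update_of_ne hi.ne, h3 i hi]
      · simp
    rw [hs]
    generalize (A.toCongest k enc).state N t v = s at *
    simp only [toCongest]
    rw [h2]
    have hdm := Nat.div_add_mod t k
    by_cases hlast : t % k + 1 = k
    · have ht : t + 1 = k * (t / k + 1) := by rw [mul_add]; omega
      have hdiv : (t + 1) / k = t / k + 1 := by rw [ht, Nat.mul_div_cancel_left _ hk]
      have hmod : (t + 1) % k = 0 := by rw [ht, Nat.mul_mod_right]
      rw [if_pos hlast, hdiv, hmod]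
      refine ⟨?_, rfl, by simp⟩
      have hset : {q : ℕ × Msg | ∀ i < k, (q.1, enc q.2 i) ∈ Function.update s.2.2 (t % k)
          (A.pieces N enc (t / k) v (t % k)) i} =
          {q | ∃ u, N.graph.Adj u v ∧ q = (N.id u, A.message (A.state N (t / k) u))} := by
        rw [← A.setOf_forall_mem_pieces N hk henc]
        ext q
        exact forall₂_congr fun i hi => by rw [hbuf i (by omega)]
      rw [hset, h1]
      rfl
    · have hlt : t % k + 1 < k := by have := Nat.mod_lt t hk; omega
      have ht : t + 1 = (t % k + 1) + k * (t / k) := by omega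
      have hdiv : (t + 1) / k = t / k := by
        rw [ht, Nat.add_mul_div_left _ _ hk, Nat.div_eq_of_lt hlt, zero_add]
      have hmod : (t + 1) % k = t % k + 1 := by
        rw [ht, Nat.add_mul_mod_self_left, Nat.mod_eq_of_lt hlt]
      rw [if_neg hlast, hdiv, hmod]
      exact ⟨h1, rfl, hbuf⟩

theorem toCongest_computesWithin (hk : 0 < k)
    (henc : ∀ g g', (∀ i < k, enc g i = enc g' i) → g = g') {T : ℕ} {out : V → Out}
    (hnone : ∀ v, ∀ t < T, A.output (A.state N t v) = none)
    (hsome : ∀ v t, T ≤ t → A.output (A.state N t v) = some (out v)) :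
    (A.toCongest k enc).ComputesWithin N (k * T) out := by
  have key (t : ℕ) (v : V) : (A.toCongest k enc).output ((A.toCongest k enc).state N t v) =
      A.output (A.state N (t / k) v) := by
    rw [← (A.toCongest_state N hk henc t v).1]; rfl
  intro v
  refine ⟨k * T, le_rfl, fun s hs => ?_, fun s hs => ?_⟩
  · rw [key]
    exact hnone v _ (Nat.div_lt_of_lt_mul hs)
  · rw [key]
    exact hsome v _ ((Nat.le_div_iff_mul_le hk).2 (by rwa [mul_comm]))

/-- A type with at most `2 ^ (B * k)` elements can be encoded by `k` messages of `B` bits. -/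
theorem exists_encoding [Fintype Msg] (h : Fintype.card Msg ≤ 2 ^ (B * k)) :
    ∃ enc : Msg → ℕ → BitVec B, ∀ g g', (∀ i < k, enc g i = enc g' i) → g = g' := by
  have hcard : Fintype.card (BitVec B) = 2 ^ B := by
    rw [Fintype.card_congr (⟨BitVec.toFin, BitVec.ofFin, fun _ => rfl, fun _ => rfl⟩ :
      BitVec B ≃ Fin (2 ^ B)), Fintype.card_fin]
  obtain ⟨φ⟩ : Nonempty (Msg ↪ (Fin k → BitVec B)) := by
    refine Function.Embedding.nonempty_of_card_le ?_
    rwa [Fintype.card_fun, hcard, Fintype.card_fin, ← pow_mul]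
  refine ⟨fun g i => if h : i < k then φ g ⟨i, h⟩ else 0, fun g g' h => φ.injective ?_⟩
  ext1 i
  simpa using h i i.2

end BroadcastAlgorithm

/-! ### Local knowledge and the schedule of announcements. -/

/-- An entry of the knowledge of a node: there is a walk of the given length to the node with
identifier `target` whose first edge leads to the neighbor with identifier `hop`. -/
structure Route where
  target : ℕ
  length : ℕ
  hop : ℕ

namespace Route

/-- The identifiers to which a route in `F` is known. -/
def targets (F : Set Route) : Set ℕ := Route.target '' F

/-- The smallest length of a route to `x` in `F`. -/
noncomputable def dist (F : Set Route) (x : ℕ) : ℕ :=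
  sInf {d | ∃ p ∈ F, p.target = x ∧ p.length = d}

/-- The targets that come before `x` in the list of all targets, ordered by distance and then by
identifier. -/
def before (F : Set Route) (x : ℕ) : Set ℕ :=
  {y ∈ targets F | dist F y < dist F x ∨ dist F y = dist F x ∧ y < x}

variable {Q : ℕ}

/-- The target `q.1` of position `q.2` in the list is announced in round `r` if its distance and
its position add up to `r`. -/
def IsDue (F : Set Route) (r : ℕ) (q : Fin Q × Fin Q) : Prop :=
  (q.1 : ℕ) ∈ targets F ∧ (before F q.1).ncard = q.2 ∧ dist F q.1 + q.2 = r

open Classical in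
/-- The announcement of a node with knowledge `F` in round `r`. The distance is not part of it,
since the receiver can infer it from `r` and the position. -/
noncomputable def announce (Q : ℕ) (F : Set Route) (r : ℕ) : Option (Fin Q × Fin Q) :=
  if h : ∃ q : Fin Q × Fin Q, IsDue F r q then some h.choose else none

/-- The routes learned from the announcements `M` of the neighbors in round `r`, where an edge of
weight `w` has length `f w`. -/
def learn (f : ℕ → ℕ) (r : ℕ) (links : Set (ℕ × ℕ)) (M : Set (ℕ × Option (Fin Q × Fin Q))) :
    Set Route :=
  {p | ∃ w q, (p.hop, w) ∈ links ∧ (p.hop, some q) ∈ M ∧ p.target = (q.1 : ℕ) ∧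
    p.length = r - q.2 + f w}

theorem exists_length_eq_dist {F : Set Route} {x : ℕ} (h : x ∈ targets F) :
    ∃ p ∈ F, p.target = x ∧ p.length = dist F x := by
  obtain ⟨p, hp, rfl⟩ := h
  exact Nat.sInf_mem (s := {d | ∃ q ∈ F, q.target = p.target ∧ q.length = d}) ⟨_, p, hp, rfl, rfl⟩

theorem dist_le {F : Set Route} {p : Route} (h : p ∈ F) : dist F p.target ≤ p.length :=
  Nat.sInf_le ⟨p, h, rfl, rfl⟩

theorem isDue_of_announce_eq {F : Set Route} {r : ℕ} {q : Fin Q × Fin Q}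
    (h : announce Q F r = some q) : IsDue F r q := by
  unfold announce at h
  split_ifs at h with h'
  obtain rfl := Option.some.inj h
  exact h'.choose_spec

/-- Of two targets, the later one in the list has a larger position and no smaller distance, so the
two sums differ. -/
theorem IsDue.unique {F : Set Route} (hF : (targets F).Finite) {r : ℕ} {p q : Fin Q × Fin Q}
    (hp : IsDue F r p) (hq : IsDue F r q) : p = q := by
  obtain ⟨hp, rp, dp⟩ := hp
  obtain ⟨hq, rq, dq⟩ := hq
  have lt {x y : ℕ} (hx : x ∈ targets F) (h : dist F x < dist F y ∨ dist F x = dist F y ∧ x < y) :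
      (before F x).ncard < (before F y).ncard := by
    refine Set.ncard_lt_ncard ((Set.ssubset_iff_of_subset fun z hz => ?_).2 ⟨x, ⟨hx, h⟩, ?_⟩)
      (hF.subset fun z hz => hz.1)
    · refine ⟨hz.1, ?_⟩
      have := hz.2
      omega
    · simp [before]
  have h1 : (p.1 : ℕ) = q.1 := by
    by_contra hne
    rcases lt_trichotomy (dist F p.1) (dist F q.1) with h | h | h
    · have := lt hp (Or.inl h); omega
    · rcases Nat.lt_or_gt_of_ne hne with h' | h'
      · have := lt hp (Or.inr ⟨h, h'⟩); omega
      · have := lt hq (Or.inr ⟨h.symm, h'⟩); omega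
    · have := lt hq (Or.inl h); omega
  refine Prod.ext (Fin.ext h1) (Fin.ext ?_)
  rw [← rp, ← rq, h1]

theorem IsDue.announce_eq {F : Set Route} (hF : (targets F).Finite) {r : ℕ} {q : Fin Q × Fin Q}
    (h : IsDue F r q) : announce Q F r = some q := by
  have h' : ∃ q : Fin Q × Fin Q, IsDue F r q := ⟨q, h⟩
  rw [announce, dif_pos h', h'.choose_spec.unique hF h]

end Route

/-! ### Pipelined flooding. -/

namespace Network

open Route

variable {V : Type*} (N : Network V) (Q : ℕ) (f : ℕ → ℕ)

/-- The knowledge of node `v` after `r` rounds of pipelined flooding, where an edge of weight `w`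
has length `f w`. -/
noncomputable def flood : ℕ → V → Set Route
  | 0, v => {⟨N.id v, 0, N.id v⟩}
  | r + 1, v => flood r v ∪ learn f r (N.localInput v).links
      {q | ∃ u, N.graph.Adj u v ∧ q = (N.id u, announce Q (flood r u) r)}

variable {N Q f}

theorem mem_flood_succ {r : ℕ} {v : V} {p : Route} :
    p ∈ N.flood Q f (r + 1) v ↔ p ∈ N.flood Q f r v ∨
      ∃ u q, N.graph.Adj v u ∧ p.hop = N.id u ∧ announce Q (N.flood Q f r u) r = some q ∧
        p.target = (q.1 : ℕ) ∧ p.length = r - q.2 + f (N.weight s(v, u)) := by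
  rw [flood, Set.mem_union]
  refine or_congr_right ?_
  simp only [learn, localInput, Set.mem_ofPred_eq, Prod.mk.injEq]
  constructor
  · rintro ⟨w, q, ⟨u, hu, hop, rfl⟩, ⟨u', hu', hop', e⟩, ht, hl⟩
    obtain rfl : u = u' := N.id_injective (hop.symm.trans hop')
    exact ⟨u, q, hu, hop, e.symm, ht, hl⟩
  · rintro ⟨u, q, hu, hop, e, ht, hl⟩
    exact ⟨_, q, ⟨u, hu, hop, rfl⟩, ⟨u, hu.symm, hop, e.symm⟩, ht, hl⟩

theorem flood_mono (v : V) : Monotone fun r => N.flood Q f r v :=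
  monotone_nat_of_le_succ fun _ _ hp => mem_flood_succ.2 (Or.inl hp)

theorem self_mem_flood (r : ℕ) (v : V) : ⟨N.id v, 0, N.id v⟩ ∈ N.flood Q f r v :=
  flood_mono v (Nat.zero_le r) rfl

/-- Every route, except for the trivial one, continues a route of the next hop. -/
theorem exists_adj_of_mem_flood {r : ℕ} {v : V} {p : Route} (h : p ∈ N.flood Q f r v) :
    (p.target = N.id v ∧ p.length = 0) ∨ ∃ u, N.graph.Adj v u ∧ p.hop = N.id u ∧
      ∃ q ∈ N.flood Q f r u, q.target = p.target ∧
        p.length = q.length + f (N.weight s(v, u)) := by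
  induction r with
  | zero =>
    obtain rfl : p = _ := h
    exact Or.inl ⟨rfl, rfl⟩
  | succ r ih =>
    rcases mem_flood_succ.1 h with h | ⟨u, q, hu, hop, ha, ht, hl⟩
    · rcases ih h with h | ⟨u, hu, hop, q, hq, h⟩
      · exact Or.inl h
      · exact Or.inr ⟨u, hu, hop, q, flood_mono u r.le_succ hq, h⟩
    · obtain ⟨hq, -, e⟩ := isDue_of_announce_eq ha
      obtain ⟨p', hp', ht', hl'⟩ := exists_length_eq_dist hq
      -- By `e`, the difference of round and position is exactly the sender's distance, without
      -- truncation.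
      exact Or.inr ⟨u, hu, hop, p', flood_mono u r.le_succ hp', ht'.trans ht.symm, by omega⟩

/-- Soundness: a premature announcement may overestimate a distance but never underestimate it. The
induction on length works because edges have positive length. -/
theorem exists_wdist_le_of_mem_flood (hf : ∀ x, 0 < f x) {r : ℕ} {v : V} {p : Route}
    (h : p ∈ N.flood Q f r v) :
    ∃ s, p.target = N.id s ∧ (N.reweight f hf).wdist v s ≤ p.length := by
  induction hl : p.length using Nat.strong_induction_on generalizing v p with
  | _ l ih =>
    rcases exists_adj_of_mem_flood h with ⟨ht, -⟩ | ⟨u, hu, -, q, hq, ht, e⟩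
    · exact ⟨v, ht, by simp⟩
    · have := hf (N.weight s(v, u))
      obtain ⟨s, hs, hle⟩ := ih q.length (by omega) hq rfl
      refine ⟨s, ht.symm.trans hs, ?_⟩
      have h1 := (N.reweight f hf).wdist_le_weight_add hu s
      have h2 : (N.reweight f hf).weight s(v, u) = f (N.weight s(v, u)) := rfl
      omega

theorem targets_flood_subset (hf : ∀ x, 0 < f x) (r : ℕ) (v : V) :
    targets (N.flood Q f r v) ⊆ Set.range N.id := by
  rintro _ ⟨p, hp, rfl⟩
  obtain ⟨s, hs, -⟩ := exists_wdist_le_of_mem_flood hf hp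
  exact ⟨s, hs.symm⟩

theorem wdist_le_dist_flood (hf : ∀ x, 0 < f x) {r : ℕ} {v s : V}
    (h : N.id s ∈ targets (N.flood Q f r v)) :
    (N.reweight f hf).wdist v s ≤ dist (N.flood Q f r v) (N.id s) := by
  obtain ⟨p, hp, ht, hl⟩ := exists_length_eq_dist h
  obtain ⟨s', hs, hle⟩ := exists_wdist_le_of_mem_flood hf hp
  obtain rfl : s' = s := N.id_injective (hs.symm.trans ht)
  omega

/-- The node `v` knows a shortest route to `s` as soon as the number of rounds reaches the sum of
the distance and the position of `s` in the list of `v`. -/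
theorem exists_mem_flood [Fintype V] (hf : ∀ x, 0 < f x) (hQ : Fintype.card V ≤ Q)
    (hid : ∀ v, N.id v < Q) {r : ℕ} {v s : V}
    (h : (N.reweight f hf).wdist v s + (N.reweight f hf).rank v s ≤ r) :
    ∃ p ∈ N.flood Q f r v, p.target = N.id s ∧ p.length = (N.reweight f hf).wdist v s := by
  induction r using Nat.strong_induction_on generalizing v s with
  | _ r ih =>
    rcases eq_or_ne v s with rfl | hvs
    · exact ⟨_, self_mem_flood r v, rfl, by simp⟩
    obtain ⟨u, hu, e⟩ := (N.reweight f hf).exists_adj_wdist_eq hvs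
    have hw : (N.reweight f hf).weight s(v, u) = f (N.weight s(v, u)) := rfl
    have hpos := hf (N.weight s(v, u))
    have hrank := rank_le_rank_of_wdist_eq (N := N.reweight f hf) hu e
    -- The round in which `u` should announce `s`; it is less than `r`, as the distance drops by a
    -- positive length and the rank does not grow.
    obtain ⟨r₀, hr₀⟩ : ∃ r₀, r₀ = (N.reweight f hf).wdist u s + (N.reweight f hf).rank u s :=
      ⟨_, rfl⟩
    have hknown (x : V) (hx : (N.reweight f hf).wdist u x + (N.reweight f hf).rank u x ≤ r₀) :
        N.id x ∈ targets (N.flood Q f r₀ u) ∧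
          dist (N.flood Q f r₀ u) (N.id x) = (N.reweight f hf).wdist u x := by
      obtain ⟨p, hp, ht, hl⟩ := ih r₀ (by omega) hx
      have hmem : N.id x ∈ targets (N.flood Q f r₀ u) := ⟨p, hp, ht⟩
      refine ⟨hmem, le_antisymm ?_ (wdist_le_dist_flood hf hmem)⟩
      rw [← hl, ← ht]
      exact dist_le hp
    obtain ⟨hs, hds⟩ := hknown s hr₀.ge
    -- The position of `s` is already its true rank: all nodes that precede `s` are known with exact
    -- distances, and no other target can come before `s`, since estimates are never too small.
    have hbefore : before (N.flood Q f r₀ u) (N.id s) =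
        N.id '' {x | (N.reweight f hf).Precedes u x s} := by
      ext y
      constructor
      · rintro ⟨hy, hlt⟩
        obtain ⟨x, rfl⟩ := targets_flood_subset hf _ _ hy
        refine ⟨x, ?_, rfl⟩
        have hle := wdist_le_dist_flood hf hy
        have hx : (N.reweight f hf).id = N.id := rfl
        simp only [Precedes, Set.mem_ofPred_eq, hx]
        omega
      · rintro ⟨x, hx, rfl⟩
        have h1 := Precedes.rank_lt hx
        have h2 := Precedes.wdist_le hx
        obtain ⟨h3, h4⟩ := hknown x (by omega)
        refine ⟨h3, ?_⟩
        rw [h4, hds]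
        exact hx
    have hlt : (N.reweight f hf).rank u s < Q := (rank_lt_card u s).trans_le hQ
    have hdue : IsDue (N.flood Q f r₀ u) r₀ (⟨N.id s, hid s⟩, ⟨_, hlt⟩) := by
      refine ⟨hs, ?_, ?_⟩
      · rw [hbefore, Set.ncard_image_of_injective _ N.id_injective]
        rfl
      · rw [hds]
        exact hr₀.symm
    have hann := hdue.announce_eq ((Set.finite_range N.id).subset (targets_flood_subset hf r₀ u))
    refine ⟨⟨N.id s, (N.reweight f hf).wdist v s, N.id u⟩,
      flood_mono v (show r₀ + 1 ≤ r by omega) (mem_flood_succ.2 (Or.inr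
        ⟨u, _, hu, rfl, hann, rfl, ?_⟩)), rfl, rfl⟩
    simp only
    omega

/-- After `r` rounds of flooding with unit lengths, every node knows at least `r / 2 + 1` nodes or
all of them. -/
theorem le_ncard_targets_flood [Fintype V] (hQ : Fintype.card V ≤ Q) (hid : ∀ v, N.id v < Q)
    (r : ℕ) (v : V) :
    min (Fintype.card V) (r / 2 + 1) ≤ (targets (N.flood Q (fun _ => 1) r v)).ncard := by
  have hf : ∀ x : ℕ, 0 < (fun _ => 1 : ℕ → ℕ) x := fun _ => one_pos
  refine (le_ncard_rank_le (N := N.reweight _ hf) v (r / 2)).trans ?_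
  rw [← Set.ncard_image_of_injective _ N.id_injective]
  refine Set.ncard_le_ncard ?_ ((Set.finite_range N.id).subset (targets_flood_subset hf r v))
  rintro _ ⟨s, hs, rfl⟩
  have h1 := wdist_le_rank (N := N.reweight _ hf) (fun _ => rfl) v s
  simp only [Set.mem_ofPred_eq] at hs
  -- Distance and rank are both at most `r / 2`.
  obtain ⟨p, hp, ht, -⟩ := exists_mem_flood (r := r) hf hQ hid (v := v) (s := s) (by omega)
  exact ⟨p, hp, ht⟩

theorem ncard_targets_flood_le [Fintype V] (hf : ∀ x, 0 < f x) (r : ℕ) (v : V) :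
    (targets (N.flood Q f r v)).ncard ≤ Fintype.card V := by
  refine (Set.ncard_le_ncard (targets_flood_subset hf r v) (Set.finite_range _)).trans ?_
  rw [← Set.image_univ, Set.ncard_image_of_injective _ N.id_injective, Set.ncard_univ,
    Nat.card_eq_fintype_card]

end Network

/-! ### The two-phase algorithm and its execution. -/

/-- The length of an edge of weight `w` at level `i`. While the number of nodes is unknown, all
lengths are `1`. Afterwards, weights are rounded up to multiples of `2 ^ i / (m * n)`. -/
def edgeLength (m : ℕ) (size : Option ℕ) (i w : ℕ) : ℕ :=
  size.elim 1 fun n => w * (m * n) / 2 ^ i + 1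

theorem edgeLength_pos (m : ℕ) (size : Option ℕ) (i w : ℕ) : 0 < edgeLength m size i w := by
  cases size <;> simp [edgeLength]

namespace Apsp

/-- The smallest cost of a route to `x`, where a route of length `d` at level `i` costs
`2 ^ i * d`. -/
noncomputable def cost {L : ℕ} (F : Fin L → Set Route) (x : ℕ) : ℕ :=
  sInf {c | ∃ i, ∃ p ∈ F i, p.target = x ∧ 2 ^ (i : ℕ) * p.length = c}

open Classical in
/-- The routing table obtained from routes at all levels, whose costs are scaled by `K`. -/
noncomputable def table (K : ℕ) {L : ℕ} (F : Fin L → Set Route) : RoutingTable where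
  dist x := if ∃ i, x ∈ Route.targets (F i) then some (cost F x / K) else none
  next x :=
    if h : ∃ y, ∃ i, ∃ p ∈ F i, p.target = x ∧ 2 ^ (i : ℕ) * p.length = cost F x ∧ p.hop = y then
      some h.choose
    else none

/-- The number of rounds of flooding with rounded weights. -/
def duration (m n : ℕ) : ℕ := 2 * (m * n) + 2 * n

/-- The state of a node: its local input, the number of nodes once it is known, the number of
rounds since the beginning of the current phase, and the routes found in this phase. -/
structure State (L : ℕ) where
  input : LocalInput
  size : Option ℕ
  time : ℕ
  routes : Fin L → Set Route

variable (Q L m : ℕ)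

/-- The state at the beginning of a phase. -/
def start (I : LocalInput) (size : Option ℕ) : State (L + 1) where
  input := I
  size := size
  time := 0
  routes _ := {⟨I.id, 0, I.id⟩}

/-- One round of flooding at all levels. -/
def advance (s : State (L + 1)) (M : Set (ℕ × (Fin (L + 1) → Option (Fin Q × Fin Q)))) :
    State (L + 1) where
  input := s.input
  size := s.size
  time := s.time + 1
  routes i := s.routes i ∪ Route.learn (edgeLength m s.size i) s.time s.input.links
    {q | ∃ g, (q.1, g) ∈ M ∧ q.2 = g i}

/-- The computation is finished. -/
def IsDone (s : State (L + 1)) : Prop := ∃ n, s.size = some n ∧ duration m n ≤ s.time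

open Classical in
/-- Approximate all-pairs shortest paths by broadcasts. In the first phase, the nodes determine
their number: it ends when the number of known nodes does not exceed half the number of rounds. In
the second phase, they flood with rounded weights at all levels. -/
noncomputable def algorithm :
    BroadcastAlgorithm (Fin (L + 1) → Option (Fin Q × Fin Q)) RoutingTable where
  State := State (L + 1)
  init I := start L I none
  message s i := Route.announce Q (s.routes i) s.time
  receive s M :=
    if IsDone L m s then s
    else if s.size = none ∧ 2 * (Route.targets ((advance Q L m s M).routes 0)).ncard ≤ s.time + 1
      then start L s.input (some ((s.time + 1) / 2))
    else advance Q L m s M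
  output s := if IsDone L m s then some (table (m * s.size.getD 0) s.routes) else none

variable {V : Type*} (N : Network V)

/-- The state of node `v` after `r` rounds of a phase. -/
noncomputable def snapshot (size : Option ℕ) (r : ℕ) (v : V) : State (L + 1) where
  input := N.localInput v
  size := size
  time := r
  routes i := N.flood Q (edgeLength m size i) r v

variable {Q L m N}

theorem advance_snapshot (size : Option ℕ) (r : ℕ) (v : V) :
    advance Q L m (snapshot Q L m N size r v)
      {q | ∃ u, N.graph.Adj u v ∧
        q = (N.id u, (algorithm Q L m).message (snapshot Q L m N size r u))} =
      snapshot Q L m N size (r + 1) v := by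
  simp only [advance, snapshot, State.mk.injEq, true_and]
  funext i
  rw [Network.flood]
  congr 2
  ext ⟨x, q⟩
  simp only [Set.mem_ofPred_eq, Prod.mk.injEq]
  constructor
  · rintro ⟨g, ⟨u, hu, rfl, rfl⟩, rfl⟩
    exact ⟨u, hu, rfl, rfl⟩
  · rintro ⟨u, hu, rfl, rfl⟩
    exact ⟨_, ⟨u, hu, rfl, rfl⟩, rfl⟩

theorem not_isDone_of_size_eq_none {s : State (L + 1)} (h : s.size = none) : ¬ IsDone L m s := by
  simp [IsDone, h]

theorem isDone_iff {s : State (L + 1)} {n : ℕ} (h : s.size = some n) :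
    IsDone L m s ↔ duration m n ≤ s.time := by
  simp [IsDone, h]

theorem state_succ_of_eq_snapshot {t r : ℕ} {size : Option ℕ}
    (h : ∀ v, (algorithm Q L m).state N t v = snapshot Q L m N size r v) (v : V) :
    (algorithm Q L m).state N (t + 1) v =
      (algorithm Q L m).receive (snapshot Q L m N size r v)
        {q | ∃ u, N.graph.Adj u v ∧
          q = (N.id u, (algorithm Q L m).message (snapshot Q L m N size r u))} := by
  simp only [BroadcastAlgorithm.state, h]

variable [Fintype V]

/-- No node stops counting early: twice the number of known nodes still exceeds the number of
rounds, by `le_ncard_targets_flood`. -/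
theorem state_eq_of_lt (hQ : Fintype.card V ≤ Q) (hid : ∀ v, N.id v < Q) {t : ℕ}
    (ht : t < 2 * Fintype.card V) (v : V) :
    (algorithm Q L m).state N t v = snapshot Q L m N none t v := by
  induction t generalizing v with
  | zero => rfl
  | succ t ih =>
    rw [state_succ_of_eq_snapshot (fun v => ih (by omega) v)]
    have h := N.le_ncard_targets_flood hQ hid (t + 1) v
    simp only [algorithm]
    rw [if_neg (not_isDone_of_size_eq_none rfl), if_neg, ← advance_snapshot]
    · rfl
    · intro h'
      have h1 := h'.2
      erw [advance_snapshot] at h1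
      change 2 * (Route.targets (N.flood Q (fun _ => 1) (t + 1) v)).ncard ≤ t + 1 at h1
      omega

/-- No more nodes can be known than exist, so the test succeeds in this round at every node. The
common switch keeps the round counters of the second phase synchronized. -/
theorem state_two_mul_card [Nonempty V] (hQ : Fintype.card V ≤ Q) (hid : ∀ v, N.id v < Q) (v : V) :
    (algorithm Q L m).state N (2 * Fintype.card V) v =
      snapshot Q L m N (some (Fintype.card V)) 0 v := by
  have hpos : 0 < Fintype.card V := Fintype.card_pos
  obtain ⟨t, ht⟩ : ∃ t, 2 * Fintype.card V = t + 1 := ⟨_, (Nat.succ_pred (by omega)).symm⟩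
  have h := N.ncard_targets_flood_le (Q := Q) (f := fun _ => 1) (fun _ => one_pos) (t + 1) v
  have hn : Fintype.card V = (t + 1) / 2 := by omega
  rw [ht, state_succ_of_eq_snapshot (fun v => state_eq_of_lt hQ hid (by omega) v)]
  simp only [algorithm]
  rw [if_neg (not_isDone_of_size_eq_none rfl), if_pos]
  · rw [hn]
    rfl
  · refine ⟨rfl, ?_⟩
    erw [advance_snapshot]
    change 2 * (Route.targets (N.flood Q (fun _ => 1) (t + 1) v)).ncard ≤ t + 1
    omega

theorem state_two_mul_card_add [Nonempty V] (hQ : Fintype.card V ≤ Q) (hid : ∀ v, N.id v < Q)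
    (r : ℕ) (v : V) :
    (algorithm Q L m).state N (2 * Fintype.card V + r) v =
      snapshot Q L m N (some (Fintype.card V)) (min r (duration m (Fintype.card V))) v := by
  induction r generalizing v with
  | zero => simpa using state_two_mul_card hQ hid v
  | succ r ih =>
    rw [← add_assoc, state_succ_of_eq_snapshot ih]
    simp only [algorithm]
    by_cases hd : duration m (Fintype.card V) ≤ r
    · rw [if_pos ((isDone_iff rfl).2 (by simpa [snapshot] using hd)), min_eq_right hd,
        min_eq_right (by omega)]
    · rw [if_neg (mt (isDone_iff rfl).1 (by simpa [snapshot] using hd)),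
        if_neg (by simp [snapshot]), min_eq_left (by omega : r ≤ _),
        min_eq_left (by omega : r + 1 ≤ _)]
      exact advance_snapshot _ _ _

/-- The table that node `v` computes. -/
noncomputable def result (Q L m : ℕ) (N : Network V) (v : V) : RoutingTable :=
  table (m * Fintype.card V) fun i : Fin (L + 1) =>
    N.flood Q (edgeLength m (some (Fintype.card V)) i) (duration m (Fintype.card V)) v

theorem output_eq_none [Nonempty V] (hQ : Fintype.card V ≤ Q) (hid : ∀ v, N.id v < Q) (v : V)
    {t : ℕ} (ht : t < 2 * Fintype.card V + duration m (Fintype.card V)) :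
    (algorithm Q L m).output ((algorithm Q L m).state N t v) = none := by
  rcases lt_or_ge t (2 * Fintype.card V) with h | h
  · rw [state_eq_of_lt hQ hid h]
    exact if_neg (not_isDone_of_size_eq_none rfl)
  · obtain ⟨r, rfl⟩ := Nat.exists_eq_add_of_le h
    rw [state_two_mul_card_add hQ hid]
    exact if_neg (mt (isDone_iff rfl).1 (by simp only [snapshot]; omega))

theorem output_eq_some [Nonempty V] (hQ : Fintype.card V ≤ Q) (hid : ∀ v, N.id v < Q) (v : V)
    {t : ℕ} (ht : 2 * Fintype.card V + duration m (Fintype.card V) ≤ t) :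
    (algorithm Q L m).output ((algorithm Q L m).state N t v) = some (result Q L m N v) := by
  obtain ⟨r, rfl⟩ := Nat.exists_eq_add_of_le (le_self_add.trans ht)
  rw [state_two_mul_card_add hQ hid, min_eq_right (by omega)]
  exact if_pos ((isDone_iff rfl).2 le_rfl)

end Apsp

/-! ### Approximation guarantee of the rounded weights. -/

namespace Apsp

theorem cost_le {L : ℕ} {F : Fin L → Set Route} {i : Fin L} {p : Route} (h : p ∈ F i) :
    cost F p.target ≤ 2 ^ (i : ℕ) * p.length :=
  Nat.sInf_le ⟨i, p, h, rfl, rfl⟩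

theorem exists_next_eq {K L : ℕ} {F : Fin L → Set Route} {x : ℕ}
    (h : ∃ i, x ∈ Route.targets (F i)) :
    ∃ i, ∃ p ∈ F i, p.target = x ∧ 2 ^ (i : ℕ) * p.length = cost F x ∧
      (table K F).next x = some p.hop := by
  obtain ⟨i, p, hp, rfl⟩ := h
  obtain ⟨j, q, hq, ht, hc⟩ := Nat.sInf_mem
    (s := {c | ∃ j, ∃ q ∈ F j, q.target = p.target ∧ 2 ^ (j : ℕ) * q.length = c})
    ⟨_, i, p, hp, rfl, rfl⟩
  have h' : ∃ y, ∃ i, ∃ q ∈ F i, q.target = p.target ∧ 2 ^ (i : ℕ) * q.length = cost F p.target ∧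
    q.hop = y := ⟨_, j, q, hq, ht, hc, rfl⟩
  obtain ⟨j, q, hq, ht, hc, e⟩ := h'.choose_spec
  exact ⟨j, q, hq, ht, hc, (dif_pos h').trans (congrArg some e.symm)⟩

variable {V : Type*} {N : Network V} {Q L m n r : ℕ}

theorem cost_self (v : V) :
    cost (fun i : Fin (L + 1) => N.flood Q (edgeLength m (some n) i) r v) (N.id v) = 0 := by
  have h := cost_le (F := fun i : Fin (L + 1) => N.flood Q (edgeLength m (some n) i) r v) (i := 0)
    (Network.self_mem_flood r v)
  simpa using h

/-- The next hop towards `w` has a route to `w` whose cost is smaller by the weight of the edge. -/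
theorem exists_adj_next_eq {v w : V} (hvw : v ≠ w)
    (h : ∃ i : Fin (L + 1), N.id w ∈ Route.targets (N.flood Q (edgeLength m (some n) i) r v)) :
    ∃ u, N.graph.Adj v u ∧
      (table (m * n) fun i : Fin (L + 1) => N.flood Q (edgeLength m (some n) i) r v).next
        (N.id w) = some (N.id u) ∧
      m * n * N.weight s(v, u) +
        cost (fun i : Fin (L + 1) => N.flood Q (edgeLength m (some n) i) r u) (N.id w) ≤
        cost (fun i : Fin (L + 1) => N.flood Q (edgeLength m (some n) i) r v) (N.id w) := by
  obtain ⟨i, p, hp, ht, hc, hnext⟩ := exists_next_eq (K := m * n) h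
  rcases Network.exists_adj_of_mem_flood hp with ⟨ht', -⟩ | ⟨u, hu, hop, q, hq, htq, hl⟩
  · exact absurd (N.id_injective (ht'.symm.trans ht)) hvw
  refine ⟨u, hu, hnext.trans (congrArg some hop), ?_⟩
  have h1 := cost_le (F := fun i : Fin (L + 1) => N.flood Q (edgeLength m (some n) i) r u) hq
  -- Lengths are rounded up, so at any level an edge costs at least its scaled weight.
  have h2 := Nat.lt_mul_div_succ (N.weight s(v, u) * (m * n)) (pow_pos two_pos (i : ℕ))
  rw [htq, ht] at h1
  rw [← hc, hl, mul_add]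
  simp only [edgeLength, Option.elim_some]
  rw [mul_comm (m * n)]
  omega

/-- The cost is a potential that strictly decreases along next hops, so the pointers cannot cycle,
and the scaled edge weights telescope. The minimizing level may change from hop to hop. -/
theorem exists_walk_next_eq (hK : 0 < m * n)
    (h : ∀ v w, ∃ i : Fin (L + 1),
      N.id w ∈ Route.targets (N.flood Q (edgeLength m (some n) i) r v)) (v w : V) :
    ∃ p : N.graph.Walk v w,
      (∀ a ∈ p.darts,
        (table (m * n) fun i : Fin (L + 1) => N.flood Q (edgeLength m (some n) i) r a.fst).next
          (N.id w) = some (N.id a.snd)) ∧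
      m * n * N.pathWeight p ≤
        cost (fun i : Fin (L + 1) => N.flood Q (edgeLength m (some n) i) r v) (N.id w) := by
  induction hc : cost (fun i : Fin (L + 1) => N.flood Q (edgeLength m (some n) i) r v) (N.id w)
    using Nat.strong_induction_on generalizing v with
  | _ c ih =>
    rcases eq_or_ne v w with rfl | hvw
    · exact ⟨SimpleGraph.Walk.nil, by simp⟩
    obtain ⟨u, hu, hnext, hle⟩ := exists_adj_next_eq hvw (h v w)
    have hpos := Nat.mul_pos hK (N.weight_pos_of_adj hu)
    obtain ⟨p, hp, hw⟩ := ih _ (by omega) u rfl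
    refine ⟨SimpleGraph.Walk.cons hu p, ?_, ?_⟩
    · simp only [SimpleGraph.Walk.darts_cons, List.mem_cons, forall_eq_or_imp]
      exact ⟨hnext, hp⟩
    · rw [Network.pathWeight_cons, mul_add]
      omega

/-- Rounding raises the cost of each edge by at most `2 ^ i`. -/
theorem two_pow_mul_pathWeight_reweight_le (i : ℕ) {v w : V} (p : N.graph.Walk v w) :
    2 ^ i * (N.reweight (edgeLength m (some n) i) (edgeLength_pos m _ i)).pathWeight p ≤
      m * n * N.pathWeight p + 2 ^ i * p.length := by
  induction p with
  | nil => exact (congrArg (2 ^ i * ·) (Network.pathWeight_nil _ _)).trans_le (by simp)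
  | @cons u v w h p ih =>
    rw [Network.pathWeight_cons, SimpleGraph.Walk.length_cons]
    erw [Network.pathWeight_cons]
    have h1 := Nat.mul_div_le (N.weight s(u, v) * (m * n)) (2 ^ i)
    have h2 : (N.reweight (edgeLength m (some n) i) (edgeLength_pos m _ i)).weight s(u, v) =
      N.weight s(u, v) * (m * n) / 2 ^ i + 1 := rfl
    rw [h2, mul_add, mul_add, mul_add, mul_add, mul_comm (m * n)]
    omega

variable [Fintype V]

theorem two_pow_mul_wdist_reweight_le (i : ℕ) (v w : V) :
    2 ^ i * (N.reweight (edgeLength m (some n) i) (edgeLength_pos m _ i)).wdist v w ≤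
      m * n * N.wdist v w + 2 ^ i * Fintype.card V := by
  obtain ⟨p, hp, e⟩ := N.exists_isPath_pathWeight_eq_wdist v w
  calc _ ≤ 2 ^ i * (N.reweight (edgeLength m (some n) i) (edgeLength_pos m _ i)).pathWeight p :=
        Nat.mul_le_mul_left _
          ((N.reweight _ (edgeLength_pos m _ i)).wdist_le_pathWeight p)
    _ ≤ m * n * N.pathWeight p + 2 ^ i * p.length := two_pow_mul_pathWeight_reweight_le i p
    _ ≤ _ := by rw [e]; gcongr; exact hp.length_lt.le

/-- The rounded distance is at most `2 * (m * n) + n` and the rank is below `n`, where `n` is the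
number of nodes; `duration` is the sum of these bounds. -/
theorem exists_mem_flood_duration (hQ : Fintype.card V ≤ Q) (hid : ∀ v, N.id v < Q) {i : ℕ}
    {v w : V} (hi : N.wdist v w < 2 ^ (i + 1)) :
    ∃ p ∈ N.flood Q (edgeLength m (some (Fintype.card V)) i) (duration m (Fintype.card V)) v,
      p.target = N.id w ∧
      2 ^ i * p.length ≤ m * Fintype.card V * N.wdist v w + 2 ^ i * Fintype.card V := by
  have hf := edgeLength_pos m (some (Fintype.card V)) i
  have h1 := two_pow_mul_wdist_reweight_le (N := N) (m := m) (n := Fintype.card V) i v w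
  have h2 : (N.reweight _ hf).wdist v w ≤ 2 * (m * Fintype.card V) + Fintype.card V := by
    refine Nat.le_of_mul_le_mul_left (h1.trans ?_) (pow_pos two_pos i)
    have := Nat.mul_le_mul_left (m * Fintype.card V) hi.le
    calc _ ≤ m * Fintype.card V * 2 ^ (i + 1) + 2 ^ i * Fintype.card V := by gcongr
      _ = _ := by ring
  have h3 := Network.rank_lt_card (N := N.reweight _ hf) v w
  obtain ⟨p, hp, ht, hl⟩ := Network.exists_mem_flood (r := duration m (Fintype.card V)) hf hQ hid
    (v := v) (s := w) (by unfold duration; omega)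
  exact ⟨p, hp, ht, by rwa [hl]⟩

theorem exists_mem_targets (hQ : Fintype.card V ≤ Q) (hid : ∀ v, N.id v < Q)
    (hL : ∀ v w, N.wdist v w < 2 ^ (L + 1)) (v w : V) :
    ∃ i : Fin (L + 1), N.id w ∈ Route.targets
      (N.flood Q (edgeLength m (some (Fintype.card V)) i) (duration m (Fintype.card V)) v) := by
  obtain ⟨p, hp, ht, -⟩ := exists_mem_flood_duration (m := m) hQ hid (hL v w)
  exact ⟨Fin.last L, p, hp, ht⟩

/-- Use the level `i` with `2 ^ i ≤ wdist < 2 ^ (i + 1)`: its rounding error is at most the distance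
times the number of nodes, a `1 / m` fraction of the scaled distance. -/
theorem mul_cost_le (hQ : Fintype.card V ≤ Q) (hid : ∀ v, N.id v < Q)
    (hL : ∀ v w, N.wdist v w < 2 ^ (L + 1)) (v w : V) :
    m * cost (fun i : Fin (L + 1) =>
      N.flood Q (edgeLength m (some (Fintype.card V)) i) (duration m (Fintype.card V)) v)
        (N.id w) ≤ (m + 1) * (m * Fintype.card V) * N.wdist v w := by
  rcases eq_or_ne v w with rfl | hvw
  · simp [cost_self]
  have hne := (N.wdist_pos hvw).ne'
  have hlog : Nat.log 2 (N.wdist v w) < L + 1 := Nat.log_lt_of_lt_pow hne (hL v w)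
  obtain ⟨p, hp, ht, hl⟩ := exists_mem_flood_duration (m := m) hQ hid
    (Nat.lt_pow_succ_log_self one_lt_two (N.wdist v w))
  have h1 := cost_le (F := fun i : Fin (L + 1) =>
    N.flood Q (edgeLength m (some (Fintype.card V)) i) (duration m (Fintype.card V)) v)
    (i := ⟨_, hlog⟩) hp
  rw [ht] at h1
  calc _ ≤ m * (m * Fintype.card V * N.wdist v w + N.wdist v w * Fintype.card V) := by
        refine Nat.mul_le_mul_left _ (h1.trans (hl.trans ?_))
        gcongr
        exact Nat.pow_log_le_self 2 hne
    _ = _ := by ring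

theorem isApproxAPSP_result {ε : ℝ} (hm : 0 < m) (hε : 1 ≤ ε * m) (hQ : Fintype.card V ≤ Q)
    (hid : ∀ v, N.id v < Q) (hL : ∀ v w, N.wdist v w < 2 ^ (L + 1)) :
    N.IsApproxAPSP ε (result Q L m N) := by
  have hn (v : V) : 0 < Fintype.card V := Fintype.card_pos_iff.2 ⟨v⟩
  have hmem := exists_mem_targets (m := m) hQ hid hL
  have hwalk (v w : V) := exists_walk_next_eq (Nat.mul_pos hm (hn v)) hmem v w
  have hcost (v w : V) : (cost (fun i : Fin (L + 1) =>
      N.flood Q (edgeLength m (some (Fintype.card V)) i) (duration m (Fintype.card V)) v)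
        (N.id w) : ℝ) ≤ (1 + ε) * N.wdist v w * (m * Fintype.card V : ℕ) := by
    have h : (m : ℝ) * cost (fun i : Fin (L + 1) =>
        N.flood Q (edgeLength m (some (Fintype.card V)) i) (duration m (Fintype.card V)) v)
          (N.id w) ≤ (m + 1) * (m * Fintype.card V : ℕ) * N.wdist v w := by
      exact_mod_cast mul_cost_le hQ hid hL v w
    refine le_of_mul_le_mul_left (h.trans ?_) (Nat.cast_pos.2 hm)
    calc ((m : ℝ) + 1) * (m * Fintype.card V : ℕ) * N.wdist v w
        ≤ (m + ε * m) * (m * Fintype.card V : ℕ) * N.wdist v w := by gcongr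
      _ = _ := by ring
  refine ⟨fun v x => ?_, fun v w d hd => ?_, fun v w => ?_⟩
  · simp only [result, table]
    split_ifs with h
    · obtain ⟨i, hi⟩ := h
      simpa using Network.targets_flood_subset (edgeLength_pos m _ i) _ _ hi
    · simp only [Option.isSome_none, Bool.false_eq_true, false_iff]
      rintro ⟨w, rfl⟩
      exact h (hmem v w)
  · have hK := Nat.mul_pos hm (hn v)
    simp only [result, table, if_pos (hmem v w), Option.mem_some_iff] at hd
    subst hd
    constructor
    · obtain ⟨p, -, hp⟩ := hwalk v w
      -- The floor in the estimate is harmless, because the true distance is an integer.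
      rw [Nat.le_div_iff_mul_le hK, mul_comm]
      exact (Nat.mul_le_mul_left _ (N.wdist_le_pathWeight p)).trans hp
    · refine Nat.cast_div_le.trans ?_
      rw [div_le_iff₀ (Nat.cast_pos.2 hK)]
      exact hcost v w
  · have hK := Nat.mul_pos hm (hn v)
    obtain ⟨p, hp, hle⟩ := hwalk v w
    refine ⟨p, hp, le_of_mul_le_mul_right ?_ (Nat.cast_pos (α := ℝ).2 hK)⟩
    refine le_trans ?_ (hcost v w)
    rw [mul_comm]
    exact_mod_cast hle

end Apsp

/-! ### Constants and the final count of rounds. -/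

/-- Nodes do not know `n`, but the message size `B` yields an upper bound for it. The 2 in `2 / β`
compensates for `log 2 ≥ 1 / 2`. -/
theorem Nat.le_two_pow_of_mul_log_le {β : ℝ} (hβ : 0 < β) {n B : ℕ} (hn : 0 < n)
    (h : β * Real.log n ≤ B) : n ≤ 2 ^ (⌈2 / β⌉₊ * B) := by
  have hB : (0 : ℝ) ≤ B := Nat.cast_nonneg B
  have hc : 2 ≤ β * ⌈2 / β⌉₊ := by
    rw [← div_le_iff₀' hβ]
    exact Nat.le_ceil _
  have h2 : (1 : ℝ) / 2 ≤ Real.log 2 := by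
    have := Real.log_two_gt_d9
    norm_num at this ⊢
    linarith
  have hlog : Real.log n ≤ Real.log ((2 : ℝ) ^ (⌈2 / β⌉₊ * B)) := by
    rw [Real.log_pow]
    push_cast
    refine le_of_mul_le_mul_left (h.trans ?_) hβ
    calc (B : ℝ) = 2 * B * (1 / 2) := by ring
      _ ≤ β * ⌈2 / β⌉₊ * B * Real.log 2 := by gcongr
      _ = _ := by ring
  have := (Real.log_le_log_iff (Nat.cast_pos.2 hn) (by positivity)).1 hlog
  exact_mod_cast this

theorem card_message_le (q L : ℕ) :
    Fintype.card (Fin L → Option (Fin (2 ^ q) × Fin (2 ^ q))) ≤ 2 ^ ((2 * q + 1) * L) := by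
  rw [Fintype.card_fun, Fintype.card_option, Fintype.card_prod, Fintype.card_fin, Fintype.card_fin,
    pow_mul]
  refine Nat.pow_le_pow_left ?_ L
  have h : 2 ^ (2 * q + 1) = 2 ^ q * 2 ^ q + 2 ^ q * 2 ^ q := by ring
  have := Nat.mul_pos (pow_pos two_pos q) (pow_pos two_pos q)
  omega

/-- The construction needs only a factor of order `1 / ε + 1 = (1 + ε) * ε / ε ^ 2`; here it is
weakened to the claimed `1 / ε ^ 2`. -/
theorem ceil_one_div_le {ε ε₀ : ℝ} (hε : 0 < ε) (h : ε ≤ ε₀) :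
    (⌈1 / ε⌉₊ : ℝ) ≤ (1 + ε₀) * ε₀ / ε ^ 2 := by
  refine (Nat.ceil_lt_add_one (by positivity)).le.trans ?_
  rw [le_div_iff₀ (by positivity)]
  have h0 : 0 ≤ 1 + ε₀ := by linarith
  calc (1 / ε + 1) * ε ^ 2 = (1 + ε) * ε := by field_simp
    _ ≤ _ := by gcongr

theorem mainTheorem2 (a : ℕ) (β₁ β₂ ε₀ : ℝ) (hβ₁ : 0 < β₁) :
    ∃ C : ℝ, ∀ ε : ℝ, 0 < ε → ε ≤ ε₀ → ∀ B : ℕ,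
      ∃ A : CongestAlgorithm B RoutingTable,
        ∀ (V : Type*) [Fintype V] (N : Network V),
          2 ≤ Fintype.card V →
          β₁ * Real.log (Fintype.card V) ≤ B →
          B ≤ β₂ * Real.log (Fintype.card V) →
          (∀ e ∈ N.graph.edgeSet, N.weight e ≤ Fintype.card V ^ a) →
          (∀ v, N.id v ≤ Fintype.card V ^ a) →
          ∃ (T : ℕ) (out : V → RoutingTable),
            (T : ℝ) ≤ C * ((Fintype.card V : ℝ) / ε ^ 2 * Real.log (Fintype.card V)) ∧
            A.ComputesWithin N T out ∧
            N.IsApproxAPSP ε out := by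
  obtain ⟨c, hc⟩ : ∃ c, c = ⌈2 / β₁⌉₊ := ⟨_, rfl⟩
  obtain ⟨e, he⟩ : ∃ e, e = c * (a + 1) + 1 := ⟨_, rfl⟩
  -- 18 is the 6 of `hT` times the 3 in `k`.
  refine ⟨18 * e ^ 2 * β₂ * ((1 + ε₀) * ε₀), fun ε hε hε₀ B => ?_⟩
  -- Chosen so that `n ^ (a + 1) ≤ 2 ^ L`, which bounds identifiers and distances.
  obtain ⟨L, hL⟩ : ∃ L, L = c * B * (a + 1) := ⟨_, rfl⟩
  obtain ⟨m, hm⟩ : ∃ m, m = ⌈1 / ε⌉₊ := ⟨_, rfl⟩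
  obtain ⟨k, hk⟩ : ∃ k, k = 3 * e ^ 2 * B := ⟨_, rfl⟩
  -- Without bits there is no admissible network, since `β₁ * log n` is positive.
  rcases Nat.eq_zero_or_pos B with hB | hB
  · refine ⟨(Apsp.algorithm 0 L m).toCongest k fun _ _ => 0, fun V _ N hn h₁ => ?_⟩
    have := Real.log_pos (show (1 : ℝ) < Fintype.card V by exact_mod_cast hn)
    rw [hB, Nat.cast_zero] at h₁
    exact absurd h₁ (not_le.2 (mul_pos hβ₁ this))
  have hcard : Fintype.card (Fin (L + 1) → Option (Fin (2 ^ (L + 1)) × Fin (2 ^ (L + 1)))) ≤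
      2 ^ (B * k) := by
    refine (card_message_le _ _).trans (Nat.pow_le_pow_right two_pos ?_)
    -- The summand 1 in `e` absorbs the 1 in `L + 1`, because `B` is positive.
    have h1 : L + 1 ≤ e * B := by rw [hL, he]; nlinarith
    calc (2 * (L + 1) + 1) * (L + 1) ≤ (3 * (L + 1)) * (L + 1) := by gcongr; omega
      _ ≤ 3 * (e * B) * (e * B) := by gcongr
      _ = B * k := by rw [hk]; ring
  obtain ⟨enc, henc⟩ := BroadcastAlgorithm.exists_encoding hcard
  refine ⟨(Apsp.algorithm (2 ^ (L + 1)) L m).toCongest k enc, fun V _ N hn h₁ h₂ hw hid => ?_⟩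
  have hn0 : 0 < Fintype.card V := by omega
  have : Nonempty V := Fintype.card_pos_iff.1 hn0
  have hk0 : 0 < k := by rw [hk, he]; positivity
  have hm0 : 0 < m := by rw [hm]; exact Nat.ceil_pos.2 (by positivity)
  have hεm : 1 ≤ ε * m := by
    rw [← div_le_iff₀' hε, hm]
    exact Nat.le_ceil _
  have hpow : Fintype.card V ^ (a + 1) < 2 ^ (L + 1) := by
    have := Nat.pow_le_pow_left (Nat.le_two_pow_of_mul_log_le hβ₁ hn0 h₁) (a + 1)
    rw [← hc, ← pow_mul, ← hL] at this
    exact this.trans_lt (Nat.pow_lt_pow_right one_lt_two L.lt_succ_self)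
  have hQ : Fintype.card V ≤ 2 ^ (L + 1) := (Nat.le_self_pow a.succ_ne_zero _).trans hpow.le
  have hid' (v : V) : N.id v < 2 ^ (L + 1) :=
    ((hid v).trans (Nat.pow_le_pow_right hn0 a.le_succ)).trans_lt hpow
  have hdist (v w : V) : N.wdist v w < 2 ^ (L + 1) := by
    refine (N.wdist_le_mul_card hw v w).trans_lt ?_
    rwa [← pow_succ']
  refine ⟨k * (2 * Fintype.card V + Apsp.duration m (Fintype.card V)),
    Apsp.result (2 ^ (L + 1)) L m N, ?_,
    BroadcastAlgorithm.toCongest_computesWithin _ N hk0 henc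
      (fun v _ => Apsp.output_eq_none hQ hid' v) (fun v _ => Apsp.output_eq_some hQ hid' v),
    Apsp.isApproxAPSP_result hm0 hεm hQ hid' hdist⟩
  have hT : k * (2 * Fintype.card V + Apsp.duration m (Fintype.card V)) ≤
      6 * Fintype.card V * (k * m) := by
    have h : Fintype.card V ≤ m * Fintype.card V := Nat.le_mul_of_pos_left _ hm0
    calc _ ≤ k * (6 * (m * Fintype.card V)) := by
          refine Nat.mul_le_mul_left _ ?_
          unfold Apsp.duration
          omega
      _ = _ := by ring
  have hkm : (k : ℝ) * m ≤
      3 * e ^ 2 * (β₂ * Real.log (Fintype.card V)) * ((1 + ε₀) * ε₀ / ε ^ 2) := by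
    have h3 : (k : ℝ) ≤ 3 * e ^ 2 * (β₂ * Real.log (Fintype.card V)) := by
      rw [hk]
      push_cast
      gcongr
    exact mul_le_mul h3 (hm ▸ ceil_one_div_le hε hε₀) (Nat.cast_nonneg _)
      ((Nat.cast_nonneg _).trans h3)
  calc ((k * (2 * Fintype.card V + Apsp.duration m (Fintype.card V)) : ℕ) : ℝ)
      ≤ 6 * Fintype.card V * (k * m) := by exact_mod_cast hT
    _ ≤ 6 * Fintype.card V *
        (3 * e ^ 2 * (β₂ * Real.log (Fintype.card V)) * ((1 + ε₀) * ε₀ / ε ^ 2)) := by gcongr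
    _ = _ := by ring
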